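/- A subset $D$ of a finite group $G$ is a $(v,k,\lambda,\mu)$-partial difference set (PDS) if $|G|=v$, $|D|=k$, every $g\in D$ can be written as $g=d_1d_2^{-1}$ with $(d_1,d_2)\in D\times D$ in exactly $\lambda$ ways, and every $g\in G\setminus(D\cup\{1\})$ can be so written in exactly $\mu$ ways. Theorem. Let $m\ge 2$ be an integer. There exists a nonabelian group $\mathcal{G}$ of order $2^{3m}$ such that, for every integer $r$ with $1\le r<m$, $\mathcal{G}$ contains a PDS with the Denniston parameters \begin{align*} v&=2^{3m},\\ k&=(2^{m+r}-2^m+2^r)(2^m-1),\\ \lambda&=2^m-2^r+(2^{m+r}-2^m+2^r)(2^r-2),\\ \mu&=(2^{m+r}-2^m+2^r)(2^r-1). \end{align*} -/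

import Mathlib

/-- `D` is a `(v, k, l, u)`-partial difference set in the finite group `G`: `G` has order `v`,
`D` has `k` elements, every `g ∈ D` is `d₁ * d₂⁻¹` for exactly `l` ordered pairs
`(d₁, d₂) ∈ D × D`, and every `g ∉ D` other than the identity is so for exactly `u` ordered
pairs. -/
structure IsPDS {G : Type*} [Group G] [Finite G] (D : Set G) (v k l u : ℕ) : Prop where
  card_group : Nat.card G = v
  card_set : D.ncard = k
  count_mem : ∀ g ∈ D, {p : G × G | p.1 ∈ D ∧ p.2 ∈ D ∧ p.1 * p.2⁻¹ = g}.ncard = l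
  count_not_mem : ∀ g ∉ D, g ≠ 1 →
    {p : G × G | p.1 ∈ D ∧ p.2 ∈ D ∧ p.1 * p.2⁻¹ = g}.ncard = u

/-- `D` is a partial difference set with the Denniston parameters for `m` and `r`.
No subtraction below truncates when `1 ≤ r < m`. -/
def IsDennistonPDS {G : Type*} [Group G] [Finite G] (D : Set G) (m r : ℕ) : Prop :=
  IsPDS D
    (2 ^ (3 * m))
    ((2 ^ (m + r) - 2 ^ m + 2 ^ r) * (2 ^ m - 1))
    (2 ^ m - 2 ^ r + (2 ^ (m + r) - 2 ^ m + 2 ^ r) * (2 ^ r - 2))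
    ((2 ^ (m + r) - 2 ^ m + 2 ^ r) * (2 ^ r - 1))

/-!
Put `q = 2 ^ m` and `n = 2 ^ r`. In the affine plane over `F = GF(q)`, Denniston's maximal arc
`{w | Q w ∈ A}`, with `Q` an anisotropic binary quadratic form and `A` an additive subgroup of `F`
of order `n`, meets each line through one of its points in `n` points: on such a line `Q` is a
constant plus an additive map `F → F` whose kernel has order at most two. Counting along lines
shows that the cone over a maximal arc is a partial difference set in the additive group of `F³`.

The form `x ^ 2 + x * y + b * y ^ 2` is invariant under the involution `(x, y) ↦ (x + y, y)`. Let
`F` act on `F²` through a nonzero additive map from `F` to the group generated by this involution.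
The resulting nonabelian group `F² ⋊ F` acts regularly on `F³` by affine maps whose linear parts
preserve the cone, so the same set is a partial difference set in it, for every `r` at once.
-/

/-- An affine maximal arc of degree `n`: every line of `V` through a point of `M` meets `M` in
exactly `n` points. A line through `w` is parametrised as `w + s • v`, which loses nothing as
`v ≠ 0`. -/
def IsMaximalArc (F : Type*) {V : Type*} [Field F] [AddCommGroup V] [Module F V] (M : Set V)
    (n : ℕ) : Prop :=
  ∀ w ∈ M, ∀ v : V, v ≠ 0 → {s : F | w + s • v ∈ M}.ncard = n

/-- A maximal arc of degree `n` in the projective space of `W`, encoded by the set `D` of nonzero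
vectors on its points. A plane `⟨p, g⟩` with `p ∈ D` then contains `n - 1` points of the arc
other than `⟨p⟩`, and each of them has exactly one representative on the affine line `g + ⟨p⟩`. -/
structure IsMaximalArcCone (F : Type*) {W : Type*} [Field F] [AddCommGroup W] [Module F W]
    (D : Set W) (n : ℕ) : Prop where
  zero_notMem : 0 ∉ D
  smul_mem : ∀ ⦃c : F⦄, c ≠ 0 → ∀ ⦃p⦄, p ∈ D → c • p ∈ D
  ncard_line : ∀ p ∈ D, ∀ g ∉ Submodule.span F {p}, {s : F | g + s • p ∈ D}.ncard = n - 1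

/-- The union of the punctured lines through the origin and a point of `M × {1}`, that is, the
cone over the copy of `M` in the affine chart of height one. -/
def coneOver (F : Type*) {V : Type*} [Field F] [AddCommGroup V] [Module F V] (M : Set V) :
    Set (V × F) :=
  {d | d.2 ≠ 0 ∧ d.2⁻¹ • d.1 ∈ M}

section DoubleCounting

theorem ncard_mul_eq_ncard_mul {α β : Type*} {S : Set α} {T : Set β} (hS : S.Finite)
    (hT : T.Finite) (r : α → β → Prop) {k l : ℕ} (hk : ∀ a ∈ S, {b | b ∈ T ∧ r a b}.ncard = k)
    (hl : ∀ b ∈ T, {a | a ∈ S ∧ r a b}.ncard = l) : S.ncard * k = T.ncard * l := by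
  classical
  lift S to Finset α using hS
  lift T to Finset β using hT
  rw [Set.ncard_coe_finset, Set.ncard_coe_finset]
  refine Finset.card_mul_eq_card_mul r (fun a ha => ?_) fun b hb => ?_
  · rw [← hk a ha, ← Set.ncard_coe_finset, Finset.coe_bipartiteAbove]; rfl
  · rw [← hl b hb, ← Set.ncard_coe_finset, Finset.coe_bipartiteBelow]; rfl

variable {F W : Type*} [Field F] [AddCommGroup W] [Module F W]

theorem ncard_compl_zero [Finite F] : ({0}ᶜ : Set F).ncard = Nat.card F - 1 := by
  rw [Set.ncard_compl, Set.ncard_singleton]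

theorem mem_span_singleton_symm {g p : W} (hg : g ≠ 0) (h : g ∈ Submodule.span F {p}) :
    p ∈ Submodule.span F {g} := by
  obtain ⟨c, rfl⟩ := Submodule.mem_span_singleton.1 h
  refine Submodule.mem_span_singleton.2 ⟨c⁻¹, inv_smul_smul₀ ?_ p⟩
  rintro rfl
  exact hg (zero_smul F p)

theorem ncard_span_singleton {p : W} (hp : p ≠ 0) :
    (Submodule.span F {p} : Set W).ncard = Nat.card F := by
  rw [← Nat.card_coe_set_eq]
  exact Nat.card_congr (LinearEquiv.toSpanNonzeroSingleton F W p hp).toEquiv.symm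

/-- Double counting of the pairs `(p, s)` with `p ∈ E`, `s ≠ 0` and `g + s • p ∈ D`. -/
theorem ncard_mul_eq_card_sub_one_mul [Finite F] [Finite W] {D E : Set W}
    (hE : ∀ ⦃c : F⦄, c ≠ 0 → ∀ ⦃p⦄, p ∈ E → c • p ∈ E) {g : W} {k : ℕ}
    (hk : ∀ p ∈ E, {s : F | s ≠ 0 ∧ g + s • p ∈ D}.ncard = k) :
    E.ncard * k = (Nat.card F - 1) * {p | p ∈ E ∧ g + p ∈ D}.ncard := by
  rw [← ncard_compl_zero]
  refine ncard_mul_eq_ncard_mul (Set.toFinite _) (Set.toFinite _) (fun p (s : F) => g + s • p ∈ D)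
    hk fun s hs => ?_
  have hs : s ≠ 0 := hs
  have hrescale : {p | p ∈ E ∧ g + s • p ∈ D} = (s • ·) ⁻¹' {p | p ∈ E ∧ g + p ∈ D} := by
    ext p
    refine and_congr_left fun _ => ⟨fun hp => hE hs hp, fun hp => ?_⟩
    simpa only [inv_smul_smul₀ hs] using hE (inv_ne_zero hs) hp
  rw [hrescale, Set.ncard_preimage_of_injective_subset_range (smul_right_injective W hs)]
  exact fun p _ => ⟨s⁻¹ • p, smul_inv_smul₀ hs p⟩

end DoubleCounting

namespace IsMaximalArcCone

variable {F W : Type*} [Field F] [AddCommGroup W] [Module F W] {D : Set W} {n : ℕ} {g p : W}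

theorem ne_zero (hD : IsMaximalArcCone F D n) (hp : p ∈ D) : p ≠ 0 :=
  fun h => hD.zero_notMem (h ▸ hp)

theorem inter_span_singleton (hD : IsMaximalArcCone F D n) (hp : p ∈ D) :
    D ∩ Submodule.span F {p} = (Submodule.span F {p} : Set W) \ {0} := by
  ext x
  refine ⟨fun ⟨hx, hxp⟩ => ⟨hxp, hD.ne_zero hx⟩, fun ⟨hxp, hx⟩ => ⟨?_, hxp⟩⟩
  obtain ⟨c, rfl⟩ := Submodule.mem_span_singleton.1 hxp
  exact hD.smul_mem (fun hc => hx (by simp [hc])) hp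

theorem ncard_inter_span_singleton (hD : IsMaximalArcCone F D n) (hp : p ∈ D) :
    (D ∩ Submodule.span F {p}).ncard = Nat.card F - 1 := by
  rw [hD.inter_span_singleton hp, Set.ncard_sdiff_singleton_of_mem (zero_mem _),
    ncard_span_singleton (hD.ne_zero hp)]

theorem ncard_inter_span_inter_translate (hD : IsMaximalArcCone F D n) (hg : g ∈ D) :
    {d | d ∈ D ∩ Submodule.span F {g} ∧ g + d ∈ D}.ncard = Nat.card F - 2 := by
  have hremove : {d | d ∈ D ∩ Submodule.span F {g} ∧ g + d ∈ D} =
      (D ∩ Submodule.span F {g}) \ {-g} := by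
    ext d
    refine and_congr_right fun ⟨_, hdg⟩ => ⟨?_, fun hd => ?_⟩
    · rintro hgd rfl
      exact hD.zero_notMem (by simpa using hgd)
    · have hspan := add_mem (Submodule.mem_span_singleton_self (R := F) g) hdg
      exact ((hD.inter_span_singleton hg).ge ⟨hspan, fun h => hd (eq_neg_of_add_eq_zero_right h)⟩).1
  have hneg : -g ∈ D ∩ Submodule.span F {g} := by
    refine ⟨?_, neg_mem (Submodule.mem_span_singleton_self g)⟩
    simpa using hD.smul_mem (neg_ne_zero.2 one_ne_zero) hg
  rw [hremove, Set.ncard_sdiff_singleton_of_mem hneg, hD.ncard_inter_span_singleton hg,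
    Nat.sub_sub]

variable [Finite F] [Finite W]

/-- Each of the `q ^ 2 - 1` lines parallel to `⟨p⟩`, other than `⟨p⟩` itself, contains `n - 1`
vectors of `D`. -/
theorem ncard_sdiff_span_singleton (hD : IsMaximalArcCone F D n) (hW : Module.finrank F W = 3)
    (hp : p ∈ D) :
    (D \ Submodule.span F {p}).ncard = (Nat.card F + 1) * (n - 1) * (Nat.card F - 1) := by
  let L : Set W := (Submodule.span F {p} : Submodule F W)
  have hcount : Lᶜ.ncard * (n - 1) = (Set.univ : Set F).ncard * (D \ L).ncard := by
    refine ncard_mul_eq_ncard_mul (Set.toFinite _) (Set.toFinite _) (fun g s => g + s • p ∈ D)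
      (fun g hg => by simpa using hD.ncard_line p hp g hg) fun s _ => ?_
    have htranslate : {g | g ∈ Lᶜ ∧ g + s • p ∈ D} = (· + s • p) ⁻¹' (D \ L) := by
      ext g
      have hsp : s • p ∈ Submodule.span F {p} :=
        Submodule.smul_mem _ s (Submodule.mem_span_singleton_self p)
      simp [L, Submodule.add_mem_iff_left _ hsp, and_comm]
    rw [htranslate, Set.ncard_preimage_of_injective_subset_range (add_left_injective _)]
    exact fun g _ => ⟨g - s • p, sub_add_cancel g _⟩
  have hcompl : Lᶜ.ncard = Nat.card F * (Nat.card F ^ 2 - 1) := by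
    rw [Set.ncard_compl, ncard_span_singleton (hD.ne_zero hp),
      Module.natCard_eq_pow_finrank (K := F), hW, Nat.mul_sub_one, ← pow_succ']
  have hsq : Nat.card F ^ 2 - 1 = (Nat.card F + 1) * (Nat.card F - 1) := by
    simpa using Nat.sq_sub_sq (Nat.card F) 1
  rw [hcompl, Set.ncard_univ, mul_assoc, hsq, mul_right_comm (_ + 1)] at hcount
  exact (Nat.eq_of_mul_eq_mul_left Nat.card_pos hcount).symm

theorem ncard_eq (hD : IsMaximalArcCone F D n) (hne : D.Nonempty)
    (hW : Module.finrank F W = 3) :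
    D.ncard = (1 + (Nat.card F + 1) * (n - 1)) * (Nat.card F - 1) := by
  obtain ⟨p, hp⟩ := hne
  rw [← Set.ncard_inter_add_ncard_sdiff_eq_ncard D (Submodule.span F {p}),
    hD.ncard_inter_span_singleton hp, hD.ncard_sdiff_span_singleton hW hp]
  ring

theorem ncard_inter_translate_of_notMem (hD : IsMaximalArcCone F D n) (hne : D.Nonempty)
    (hW : Module.finrank F W = 3) (hg : g ∉ D) (hg0 : g ≠ 0) :
    {d | d ∈ D ∧ g + d ∈ D}.ncard = (1 + (Nat.card F + 1) * (n - 1)) * (n - 1) := by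
  have hline : ∀ p ∈ D, {s : F | s ≠ 0 ∧ g + s • p ∈ D}.ncard = n - 1 := by
    intro p hp
    have hgp : g ∉ Submodule.span F {p} := fun hgp =>
      hg ((hD.inter_span_singleton hp).ge ⟨hgp, hg0⟩).1
    rw [← hD.ncard_line p hp g hgp]
    congr 1
    ext s
    refine and_iff_right_of_imp ?_
    rintro hs rfl
    exact hg (by simpa using hs)
  have hcount := ncard_mul_eq_card_sub_one_mul hD.smul_mem hline
  rw [hD.ncard_eq hne hW, mul_right_comm, mul_comm] at hcount
  exact (Nat.eq_of_mul_eq_mul_left (Nat.sub_pos_of_lt Finite.one_lt_card) hcount).symm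

theorem ncard_sdiff_span_inter_translate (hD : IsMaximalArcCone F D n)
    (hW : Module.finrank F W = 3) (hg : g ∈ D) :
    {d | d ∈ D \ Submodule.span F {g} ∧ g + d ∈ D}.ncard =
      (Nat.card F + 1) * (n - 1) * (n - 2) := by
  have hsmul : ∀ ⦃c : F⦄, c ≠ 0 → ∀ ⦃p⦄, p ∈ D \ Submodule.span F {g} →
      c • p ∈ D \ Submodule.span F {g} := fun c hc p hp =>
    ⟨hD.smul_mem hc hp.1, fun h => hp.2 ((Submodule.smul_mem_iff _ hc).1 h)⟩
  have hline : ∀ p ∈ D \ Submodule.span F {g},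
      {s : F | s ≠ 0 ∧ g + s • p ∈ D}.ncard = n - 2 := by
    rintro p ⟨hp, hpg⟩
    have hgp : g ∉ Submodule.span F {p} := fun hgp =>
      hpg (mem_span_singleton_symm (hD.ne_zero hg) hgp)
    have hremove : {s : F | s ≠ 0 ∧ g + s • p ∈ D} = {s : F | g + s • p ∈ D} \ {0} := by
      ext s
      exact and_comm
    rw [hremove, Set.ncard_sdiff_singleton_of_mem (by simpa using hg),
      hD.ncard_line p hp g hgp, Nat.sub_sub]
  have hcount := ncard_mul_eq_card_sub_one_mul hsmul hline
  rw [hD.ncard_sdiff_span_singleton hW hg, mul_right_comm, mul_comm] at hcount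
  exact (Nat.eq_of_mul_eq_mul_left (Nat.sub_pos_of_lt Finite.one_lt_card) hcount).symm

theorem ncard_inter_translate_of_mem (hD : IsMaximalArcCone F D n)
    (hW : Module.finrank F W = 3) (hg : g ∈ D) :
    {d | d ∈ D ∧ g + d ∈ D}.ncard =
      Nat.card F - 2 + (Nat.card F + 1) * (n - 1) * (n - 2) := by
  rw [← hD.ncard_inter_span_inter_translate hg, ← hD.ncard_sdiff_span_inter_translate hW hg,
    ← Set.ncard_inter_add_ncard_sdiff_eq_ncard _ (Submodule.span F {g} : Set W)]
  congr 2 <;> ext d <;> simp [and_right_comm]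

end IsMaximalArcCone

section ConeOver

variable {F V : Type*} [Field F] [AddCommGroup V] [Module F V] {M : Set V} {n : ℕ}

theorem mem_coneOver {w : V} {z : F} : (w, z) ∈ coneOver F M ↔ z ≠ 0 ∧ z⁻¹ • w ∈ M := Iff.rfl

theorem nonempty_coneOver (hne : M.Nonempty) : (coneOver F M).Nonempty :=
  hne.imp' (fun w => (w, 1)) fun w hw => mem_coneOver.2 ⟨one_ne_zero, by simpa using hw⟩

theorem IsMaximalArc.ncard_ne_zero (hM : IsMaximalArc F M n) {w v : V} (hw : w ∈ M)
    (hv : v ≠ 0) : {s : F | s ≠ 0 ∧ w + s • v ∈ M}.ncard = n - 1 := by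
  rw [← hM w hw v hv, ← Set.ncard_sdiff_singleton_of_mem (a := (0 : F)) (by simpa using hw)]
  congr 1
  ext s
  exact and_comm

/-- The vector `(v, t) + s • (w, z)` of height `c = t + s * z` projects to the point `x + c⁻¹ • y`
of the affine chart, where `x = z⁻¹ • w` lies on the arc. -/
theorem IsMaximalArc.isMaximalArcCone_coneOver (hM : IsMaximalArc F M n) :
    IsMaximalArcCone F (coneOver F M) n where
  zero_notMem h := h.1 rfl
  smul_mem := by
    rintro c hc ⟨w, z⟩ ⟨hz, hw⟩
    refine mem_coneOver.2 ⟨mul_ne_zero hc hz, ?_⟩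
    rwa [smul_eq_mul, mul_inv_rev, mul_smul, inv_smul_smul₀ hc]
  ncard_line := by
    rintro ⟨w, z⟩ ⟨hz, hw⟩ ⟨v, t⟩ hg
    have hy : v - t • z⁻¹ • w ≠ 0 := by
      refine fun h => hg (Submodule.mem_span_singleton.2 ⟨t * z⁻¹, ?_⟩)
      rw [Prod.smul_mk, mul_smul, ← sub_eq_zero.1 h, smul_eq_mul, inv_mul_cancel_right₀ hz]
    have hpreimage : {s : F | (v, t) + s • (w, z) ∈ coneOver F M} =
        (fun s => (t + s * z)⁻¹) ⁻¹'
          {r | r ≠ 0 ∧ z⁻¹ • w + r • (v - t • z⁻¹ • w) ∈ M} := by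
      ext s
      simp only [Set.mem_ofPred_eq, Set.mem_preimage, Prod.smul_mk, Prod.mk_add_mk, mem_coneOver,
        smul_eq_mul, ne_eq, inv_eq_zero]
      refine and_congr_right fun hc => ?_
      have hproj : (t + s * z)⁻¹ • (v + s • w) =
          z⁻¹ • w + (t + s * z)⁻¹ • (v - t • z⁻¹ • w) := by
        rw [inv_smul_eq_iff₀ hc, smul_add, smul_inv_smul₀ hc, add_smul, mul_smul,
          smul_inv_smul₀ hz]
        abel
      rw [hproj]
    rw [hpreimage, Set.ncard_preimage_of_injective_subset_range, hM.ncard_ne_zero hw hy]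
    · exact inv_injective.comp ((add_right_injective t).comp (mul_left_injective₀ hz))
    · exact fun r _ => ⟨(r⁻¹ - t) * z⁻¹, by simp [inv_mul_cancel_right₀ hz]⟩

end ConeOver

section PartialDifferenceSet

theorem ncard_mul_inv_eq {G : Type*} [Group G] (D : Set G) (g : G) :
    {p : G × G | p.1 ∈ D ∧ p.2 ∈ D ∧ p.1 * p.2⁻¹ = g}.ncard = {d | d ∈ D ∧ g * d ∈ D}.ncard := by
  refine Set.ncard_congr (fun p _ => p.2) ?_ ?_ ?_
  · rintro ⟨x, y⟩ ⟨hx, hy, rfl⟩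
    exact ⟨hy, by simpa using hx⟩
  · rintro ⟨x, y⟩ ⟨x', y'⟩ ⟨-, -, h⟩ ⟨-, -, h'⟩ (rfl : y = y')
    exact Prod.ext (mul_right_cancel (h.trans h'.symm)) rfl
  · exact fun d ⟨hd, hgd⟩ => ⟨(g * d, d), ⟨hgd, hd, mul_inv_cancel_right g d⟩, rfl⟩

/-- Through `e`, left multiplication by `g` becomes `h ↦ e g * σ g h`, and `σ g` preserves `D`:
the quotients in `G` are counted by those in `H`. -/
theorem IsPDS.preimage_of_twisted {G H : Type*} [Group G] [Finite G] [Group H] [Finite H]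
    {D : Set H} {v k l u : ℕ} (hD : IsPDS D v k l u) (e : G ≃ H) (σ : G → MulAut H)
    (he : ∀ g x, e (g * x) = e g * σ g (e x)) (hσ : ∀ g y, σ g y ∈ D ↔ y ∈ D) :
    IsPDS (e ⁻¹' D) v k l u := by
  have hcount (g : G) : {p : G × G | p.1 ∈ e ⁻¹' D ∧ p.2 ∈ e ⁻¹' D ∧ p.1 * p.2⁻¹ = g}.ncard =
      {p : H × H | p.1 ∈ D ∧ p.2 ∈ D ∧ p.1 * p.2⁻¹ = e g}.ncard := by
    rw [ncard_mul_inv_eq, ncard_mul_inv_eq, ← Set.ncard_preimage_of_injective_subset_range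
      (e.trans (σ g).toEquiv).injective (by simp)]
    congr 1
    ext x
    simp [he, hσ]
  have hone : e 1 = 1 := by
    have h := he 1 1
    rwa [mul_one, left_eq_mul, map_eq_one_iff _ (σ 1).injective] at h
  refine ⟨(Nat.card_congr e).trans hD.card_group, ?_, fun g hg => ?_, fun g hg hg1 => ?_⟩
  · rw [Set.ncard_preimage_of_injective_subset_range e.injective (by simp), hD.card_set]
  · rw [hcount, hD.count_mem _ hg]
  · rw [hcount, hD.count_not_mem _ hg fun h => hg1 (e.injective (h.trans hone.symm))]

theorem IsMaximalArcCone.isPDS {F W : Type*} [Field F] [Finite F] [AddCommGroup W] [Module F W]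
    [Finite W] {D : Set W} {n : ℕ} (hD : IsMaximalArcCone F D n) (hne : D.Nonempty)
    (hW : Module.finrank F W = 3) :
    IsPDS (Multiplicative.toAdd ⁻¹' D) (Nat.card F ^ 3)
      ((1 + (Nat.card F + 1) * (n - 1)) * (Nat.card F - 1))
      (Nat.card F - 2 + (Nat.card F + 1) * (n - 1) * (n - 2))
      ((1 + (Nat.card F + 1) * (n - 1)) * (n - 1)) where
  card_group := by
    rw [Nat.card_congr Multiplicative.toAdd, Module.natCard_eq_pow_finrank (K := F), hW]
  card_set := hD.ncard_eq hne hW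
  count_mem g hg := by
    rw [ncard_mul_inv_eq]
    exact hD.ncard_inter_translate_of_mem hW hg
  count_not_mem g hg hg1 := by
    rw [ncard_mul_inv_eq]
    exact hD.ncard_inter_translate_of_notMem hne hW hg hg1

end PartialDifferenceSet

section Semidirect

theorem exists_mul_ne_mul_of_apply_ne {N G : Type*} [Group N] [Group G] {φ : G →* MulAut N}
    {g : G} {n : N} (h : φ g n ≠ n) : ∃ a b : N ⋊[φ] G, a * b ≠ b * a := by
  refine ⟨SemidirectProduct.inr g, SemidirectProduct.inl n, fun hcomm => h ?_⟩
  rw [← SemidirectProduct.inl_inj (φ := φ), SemidirectProduct.inl_aut, hcomm, map_inv,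
    mul_inv_cancel_right]

instance finite_semidirectProduct {N G : Type*} [Group N] [Group G] [Finite N] [Finite G]
    {φ : G →* MulAut N} : Finite (N ⋊[φ] G) :=
  .of_equiv _ SemidirectProduct.equivProd.symm

variable {F V : Type*} [Field F] [AddCommGroup V] [Module F V]

/-- A linear representation as an action by automorphisms on the additive group of the
representation space, as required to form semidirect products. -/
def linearAction {H : Type*} [Group H] (ρ : H →* V ≃ₗ[F] V) : H →* MulAut (Multiplicative V) :=
  (MulAutMultiplicative V).symm.toMonoidHom.comp ((DistribMulAction.toAddAut (V ≃ₗ[F] V) V).comp ρ)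

theorem linearAction_apply {H : Type*} [Group H] (ρ : H →* V ≃ₗ[F] V) (h : H) (v : V) :
    linearAction ρ h (Multiplicative.ofAdd v) = Multiplicative.ofAdd (ρ h v) := rfl

/-- The underlying vector space of a semidirect product of `V` and `F`, where the height `F` of
`V × F` acts on `V`. -/
def semidirectEquivProd (ρ : Multiplicative F →* V ≃ₗ[F] V) :
    Multiplicative V ⋊[linearAction ρ] Multiplicative F ≃ Multiplicative (V × F) :=
  SemidirectProduct.equivProd.trans (MulEquiv.prodMultiplicative V F).symm.toEquiv

theorem IsMaximalArc.isPDS_semidirectProduct [Finite F] [Finite V] {M : Set V} {n : ℕ}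
    (hM : IsMaximalArc F M n) (hne : M.Nonempty) (hV : Module.finrank F V = 2)
    (ρ : Multiplicative F →* V ≃ₗ[F] V) (hρ : ∀ z w, ρ z w ∈ M ↔ w ∈ M) :
    IsPDS (semidirectEquivProd ρ ⁻¹' (Multiplicative.toAdd ⁻¹' coneOver F M)) (Nat.card F ^ 3)
      ((1 + (Nat.card F + 1) * (n - 1)) * (Nat.card F - 1))
      (Nat.card F - 2 + (Nat.card F + 1) * (n - 1) * (n - 2))
      ((1 + (Nat.card F + 1) * (n - 1)) * (n - 1)) := by
  have hcone := hM.isMaximalArcCone_coneOver.isPDS (nonempty_coneOver hne) (by simp [hV])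
  let σ (g : Multiplicative V ⋊[linearAction ρ] Multiplicative F) :
      MulAut (Multiplicative (V × F)) :=
    ((ρ g.right).toAddEquiv.prodCongr (.refl F)).toMultiplicative
  refine hcone.preimage_of_twisted _ σ (fun g x => rfl) fun g y => and_congr_right fun _ => ?_
  rw [← hρ g.right (y.toAdd.2⁻¹ • y.toAdd.1), map_smul]
  rfl

end Semidirect

section Arc

theorem card_comap_of_sup_range_eq_top {G : Type*} [AddCommGroup G] [Finite G] {A : AddSubgroup G}
    {f : G →+ G} (h : A ⊔ f.range = ⊤) : Nat.card (A.comap f) = Nat.card A := by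
  have hindex : (A.comap f).index = A.index := by
    rw [AddSubgroup.index_comap, ← AddSubgroup.relIndex_sup_left, h,
      AddSubgroup.relIndex_top_right]
  have hcard := (A.comap f).card_mul_index.trans A.card_mul_index.symm
  rw [hindex] at hcard
  exact Nat.eq_of_mul_eq_mul_right (Nat.pos_of_ne_zero AddSubgroup.FiniteIndex.index_ne_zero) hcard

variable {F V : Type*} [Field F] [CharP F 2] [AddCommGroup V] [Module F V] {Q : QuadraticForm F V}

/-- The increment `s ↦ Q (w + s • v) - Q w`, additive because squaring is in characteristic two. -/
def increment (Q : QuadraticForm F V) (w v : V) : F →+ F where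
  toFun s := s * QuadraticMap.polar Q w v + s ^ 2 * Q v
  map_zero' := by simp
  map_add' s t := by
    rw [CharTwo.add_sq]
    ring

theorem increment_apply (w v : V) (s : F) :
    increment Q w v s = s * QuadraticMap.polar Q w v + s ^ 2 * Q v := rfl

theorem map_add_smul_eq_add_increment (w v : V) (s : F) :
    Q (w + s • v) = Q w + increment Q w v s := by
  rw [QuadraticMap.map_add Q, QuadraticMap.map_smul, QuadraticMap.polar_smul_right, increment_apply,
    smul_eq_mul, smul_eq_mul]
  ring

theorem polar_eq_zero_of_mem_range_increment (hQ : Q.Anisotropic) {w v : V}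
    (h : Q w ∈ (increment Q w v).range) : QuadraticMap.polar Q w v = 0 := by
  obtain ⟨s, hs⟩ := h
  have hzero : w + s • v = 0 := hQ _ (by
    rw [map_add_smul_eq_add_increment, hs, CharTwo.add_self_eq_zero])
  rw [eq_neg_of_add_eq_zero_left hzero, ← neg_smul, QuadraticMap.polar_smul_left,
    QuadraticMap.polar_self, CharTwo.two_nsmul, smul_zero]

theorem card_ker_increment_le_two (hQ : Q.Anisotropic) (w : V) {v : V} (hv : v ≠ 0) :
    Nat.card (increment Q w v).ker ≤ 2 := by
  have hQv : Q v ≠ 0 := mt (hQ v) hv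
  have hsubset : ((increment Q w v).ker : Set F) ⊆ {0, QuadraticMap.polar Q w v / Q v} := by
    intro s hs
    have hfactor : s * (s * Q v + QuadraticMap.polar Q w v) = 0 := by
      rw [← show increment Q w v s = 0 from hs, increment_apply]
      ring
    refine (mul_eq_zero.1 hfactor).imp_right fun h => ?_
    exact (eq_div_iff hQv).2 (CharTwo.add_eq_zero.1 h)
  exact (Set.ncard_le_ncard hsubset).trans
    ((Set.ncard_insert_le _ _).trans (by rw [Set.ncard_singleton]))

variable [Finite F]

theorem range_increment_eq_top_of_polar_eq_zero (hQ : Q.Anisotropic) {w v : V} (hv : v ≠ 0)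
    (h : QuadraticMap.polar Q w v = 0) : (increment Q w v).range = ⊤ := by
  rw [AddMonoidHom.range_eq_top, ← Finite.injective_iff_surjective, injective_iff_map_eq_zero]
  intro s hs
  simpa [increment_apply, h, mt (hQ v) hv] using hs

theorem sup_range_increment_eq_top (hQ : Q.Anisotropic) {A : AddSubgroup F} {w v : V}
    (hw : Q w ∈ A) (hv : v ≠ 0) : A ⊔ (increment Q w v).range = ⊤ := by
  by_cases hmem : Q w ∈ (increment Q w v).range
  · rw [range_increment_eq_top_of_polar_eq_zero hQ hv
      (polar_eq_zero_of_mem_range_increment hQ hmem), sup_top_eq]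
  · have hindex : (increment Q w v).range.index ≤ 2 :=
      (AddSubgroup.index_range).trans_le (card_ker_increment_le_two hQ w hv)
    have hlt : (increment Q w v).range < A ⊔ (increment Q w v).range :=
      lt_of_le_of_ne le_sup_right fun h => hmem (h ▸ AddSubgroup.mem_sup_left hw)
    have hne : (A ⊔ (increment Q w v).range).index ≠ 0 := AddSubgroup.FiniteIndex.index_ne_zero
    have := AddSubgroup.index_strictAnti hlt
    exact AddSubgroup.index_eq_one.1 (by omega)

theorem isMaximalArc_preimage (hQ : Q.Anisotropic) (A : AddSubgroup F) :
    IsMaximalArc F (Q ⁻¹' A) (Nat.card A) := by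
  intro w hw v hv
  have hcomap : {s : F | w + s • v ∈ Q ⁻¹' A} = (A.comap (increment Q w v) : Set F) := by
    ext s
    simp only [Set.mem_ofPred_eq, Set.mem_preimage, map_add_smul_eq_add_increment]
    exact add_mem_cancel_left hw
  rw [hcomap, ← card_comap_of_sup_range_eq_top (sup_range_increment_eq_top hQ hw hv)]
  rfl

end Arc

section BinaryForm

/-- The binary quadratic form `x ^ 2 + x * y + b * y ^ 2`. -/
def binaryForm {R : Type*} [CommRing R] (b : R) : QuadraticForm R (R × R) :=
  .linMulLin (.fst R R R) (.fst R R R + .snd R R R) + b • .linMulLin (.snd R R R) (.snd R R R)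

theorem binaryForm_apply {R : Type*} [CommRing R] (b : R) (w : R × R) :
    binaryForm b w = w.1 * (w.1 + w.2) + b * (w.2 * w.2) := rfl

variable {F : Type*} [Field F]

theorem anisotropic_binaryForm {b : F} (hb : ∀ s : F, s ^ 2 + s + b ≠ 0) :
    (binaryForm b).Anisotropic := by
  rintro ⟨x, y⟩ (h : x * (x + y) + b * (y * y) = 0)
  by_cases hy : y = 0
  · have hx : x = 0 := by simpa [hy] using h
    rw [hx, hy, Prod.mk_zero_zero]
  · refine absurd ?_ (hb (x / y))
    field_simp
    linear_combination h

/-- The transvection `(x, y) ↦ (x + y, y)`. -/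
def shear (F : Type*) [Field F] : (F × F) ≃ₗ[F] F × F :=
  .transvection (f := .snd F F F) (v := (1, 0)) rfl

theorem shear_apply (w : F × F) : shear F w = (w.1 + w.2, w.2) := by
  rw [show shear F w = w + w.2 • (1, 0) from rfl]
  ext <;> simp

variable [CharP F 2]

theorem shear_mul_shear : shear F * shear F = 1 := by
  ext w <;> simp [shear_apply, CharTwo.add_self_eq_zero, add_assoc]

theorem binaryForm_shear (b : F) (w : F × F) : binaryForm b (shear F w) = binaryForm b w := by
  rw [shear_apply, binaryForm_apply, binaryForm_apply, add_assoc, CharTwo.add_self_eq_zero]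
  ring

variable (F) in
theorem exists_forall_sq_add_self_add_ne_zero [Finite F] :
    ∃ b : F, ∀ s : F, s ^ 2 + s + b ≠ 0 := by
  have hinj : ¬ Function.Injective fun s : F => s ^ 2 + s := fun h =>
    zero_ne_one (h (by simp [CharTwo.add_self_eq_zero]))
  rw [Finite.injective_iff_surjective, Function.Surjective, not_forall] at hinj
  obtain ⟨b, hb⟩ := hinj
  exact ⟨b, fun s hs => hb ⟨s, CharTwo.add_eq_zero.1 hs⟩⟩

end BinaryForm

theorem exists_monoidHom_range_eq_pair (K : Type*) [AddCommGroup K] [Module (ZMod 2) K]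
    [Nontrivial K] {H : Type*} [Group H] {τ : H} (hτ : τ * τ = 1) :
    ∃ ρ : Multiplicative K →* H, Set.range ρ = {1, τ} := by
  obtain ⟨x, hx⟩ := exists_ne (0 : K)
  obtain ⟨f, hf⟩ := not_forall.1 (mt (Module.forall_dual_apply_eq_zero_iff (ZMod 2) x).1 hx)
  have hbit : ∀ a : ZMod 2, a = 0 ∨ a = 1 := by decide
  have hadd (a b : ZMod 2) : τ ^ (a + b).val = τ ^ a.val * τ ^ b.val := by
    rcases hbit a with rfl | rfl <;> rcases hbit b with rfl | rfl <;>
      simp [hτ, CharTwo.add_self_eq_zero, ZMod.val_one]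
  refine ⟨.mk' (fun z => τ ^ (f z.toAdd).val) fun a b => by rw [toAdd_mul, map_add, hadd], ?_⟩
  refine Set.Subset.antisymm ?_ ?_
  · rintro _ ⟨z, rfl⟩
    rcases hbit (f z.toAdd) with h | h <;> simp [h, ZMod.val_one]
  · rintro _ (rfl | rfl)
    · exact ⟨1, map_one _⟩
    · exact ⟨.ofAdd x, by simp [(hbit (f x)).resolve_left hf, ZMod.val_one]⟩

theorem exists_addSubgroup_card_eq_pow_prime {M : Type*} [AddGroup M] [Finite M] {p n : ℕ}
    [Fact p.Prime] (h : p ^ n ∣ Nat.card M) : ∃ A : AddSubgroup M, Nat.card A = p ^ n := by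
  obtain ⟨K, hK⟩ := Sylow.exists_subgroup_card_pow_prime (G := Multiplicative M) p h
  exact ⟨Subgroup.toAddSubgroup' K, hK⟩

theorem IsPDS.isDennistonPDS {G : Type*} [Group G] [Finite G] {D : Set G} {m r : ℕ} (hr : 1 ≤ r)
    (hrm : r ≤ m)
    (hD : IsPDS D ((2 ^ m) ^ 3) ((1 + (2 ^ m + 1) * (2 ^ r - 1)) * (2 ^ m - 1))
      (2 ^ m - 2 + (2 ^ m + 1) * (2 ^ r - 1) * (2 ^ r - 2))
      ((1 + (2 ^ m + 1) * (2 ^ r - 1)) * (2 ^ r - 1))) :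
    IsDennistonPDS D m r := by
  have hn : 2 ≤ 2 ^ r := by simpa only [pow_one] using Nat.pow_le_pow_right two_pos hr
  have hnq : 2 ^ r ≤ 2 ^ m := Nat.pow_le_pow_right two_pos hrm
  have hpoints : 2 ^ (m + r) - 2 ^ m + 2 ^ r = 1 + (2 ^ m + 1) * (2 ^ r - 1) := by
    have : 2 ^ m ≤ 2 ^ m * 2 ^ r := Nat.le_mul_of_pos_right _ (by positivity)
    zify [pow_add, this, Nat.one_le_two_pow (n := r)]
    ring
  have hlam : 2 ^ m - 2 ^ r + (1 + (2 ^ m + 1) * (2 ^ r - 1)) * (2 ^ r - 2) =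
      2 ^ m - 2 + (2 ^ m + 1) * (2 ^ r - 1) * (2 ^ r - 2) := by
    rw [one_add_mul, ← add_assoc, Nat.sub_add_sub_cancel hnq hn]
  rwa [IsDennistonPDS, hpoints, hlam, mul_comm 3, pow_mul]

theorem theorem6p2 (m : ℕ) (hm : 2 ≤ m) :
    ∃ (G : Type) (_ : Group G) (_ : Finite G),
      (∃ a b : G, a * b ≠ b * a) ∧
      ∀ r : ℕ, 1 ≤ r → r < m → ∃ D : Set G, IsDennistonPDS D m r := by
  let F := GaloisField 2 m
  have hF : Nat.card F = 2 ^ m := GaloisField.card 2 m (by omega)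
  obtain ⟨b, hb⟩ := exists_forall_sq_add_self_add_ne_zero F
  obtain ⟨ρ, hρ⟩ := exists_monoidHom_range_eq_pair F (shear_mul_shear (F := F))
  have hinvariant (z : Multiplicative F) (w : F × F) : binaryForm b (ρ z w) = binaryForm b w := by
    rcases hρ.le (Set.mem_range_self z) with h | h <;> rw [h]
    exacts [rfl, binaryForm_shear b w]
  refine ⟨Multiplicative (F × F) ⋊[linearAction ρ] Multiplicative F, inferInstance, inferInstance,
    ?_, fun r hr hrm => ?_⟩
  · obtain ⟨z, hz⟩ := hρ.ge (Set.mem_insert_of_mem _ rfl)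
    refine exists_mul_ne_mul_of_apply_ne (g := z) (n := .ofAdd ((0, 1) : F × F)) ?_
    rw [linearAction_apply, hz, shear_apply]
    simp
  · obtain ⟨A, hA⟩ := exists_addSubgroup_card_eq_pow_prime (p := 2) (n := r)
      (hF ▸ pow_dvd_pow 2 hrm.le)
    have hpds := (isMaximalArc_preimage (anisotropic_binaryForm hb) A).isPDS_semidirectProduct
      ⟨0, by simp⟩ (by simp) ρ fun z w => by simp only [Set.mem_preimage, hinvariant]
    rw [hF, hA] at hpds
    exact ⟨_, hpds.isDennistonPDS hr hrm.le⟩
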